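/- **Theorem (Deformation theorem for the second moment, additive case).** Let $N\ge 1$. A *GUE matrix* is a random Hermitian $N\times N$ matrix $X$ whose entries on and above the diagonal are independent centered Gaussians, real on the diagonal with variance $1/N$, and, above the diagonal, complex with independent real and imaginary parts of variance $1/(2N)$. For $s>0$ and $\tau\in\mathbb{C}$, write $Z_{s,\tau}$ for a *rotated elliptic matrix* with variance parameter $s$ and covariance parameter $\tau$, that is, a random $N\times N$ matrix $Z$ having the same distribution as $e^{i\theta}(aX+ibY)$, where $X,Y$ are independent GUE matrices and $\theta,a,b$ are real with $a,b$ not both zero, such that $$s=\mathbb{E}\Big\{\tfrac1N\operatorname{Trace}(Z^*Z)\Big\},\qquad \tau=\mathbb{E}\Big\{\tfrac1N\operatorname{Trace}(Z^*Z)\Big\}-\mathbb{E}\Big\{\tfrac1N\operatorname{Trace}(Z^2)\Big\}.$$ Let $s>0$ and let $\tau_0,\tau\in\mathbb{C}$ satisfy $|\tau_0-s|\le s$ and $|\tau-s|\le s$. Let $X_0$ be a random $N\times N$ complex matrix (not necessarily Hermitian) that is independent of $Z_{s,\tau_0}$ and independent of $Z_{s,\tau}$. Then, for every $z\in\mathbb{C}$,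 $$\mathbb{E}\Big\{\big|\det\big(z-(X_0+Z_{s,\tau})\big)\big|^2\Big\}=\mathbb{E}\left\{\left|\exp\Big(\frac{\tau-\tau_0}{2N}\frac{\partial^2}{\partial z^2}\Big)\det\big(z-(X_0+Z_{s,\tau_0})\big)\right|^2\right\},$$ where the exponential, applied to the polynomial $z\mapsto\det(z-(X_0+Z_{s,\tau_0}))$, is the terminating power series $\sum_{k\ge0}\frac{1}{k!}\big(\frac{\tau-\tau_0}{2N}\big)^k\frac{\partial^{2k}}{\partial z^{2k}}$. The expectations are taken in $[0,\infty]$, so no moment assumption on $X_0$ is needed. -/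

import Mathlib

open MeasureTheory ProbabilityTheory

noncomputable section

/-- The product (Borel) σ-algebra on complex matrices: a random matrix is measurable iff all of its
entries are. -/
instance matrixMeasurableSpace (N : ℕ) : MeasurableSpace (Matrix (Fin N) (Fin N) ℂ) :=
  inferInstanceAs (MeasurableSpace (Fin N → Fin N → ℂ))

/-- The Hermitian `N × N` matrix with real coordinates `g`: the diagonal entries are `g i i`, and
for `i < j` the `(i, j)` entry is `(g i j + √-1 * g j i) / √2`. -/
def hermitianOfCoords (N : ℕ) (g : Fin N × Fin N → ℝ) : Matrix (Fin N) (Fin N) ℂ :=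
  Matrix.of fun i j =>
    if i = j then (g (i, i) : ℂ)
    else if i < j then ((g (i, j) : ℂ) + Complex.I * (g (j, i) : ℂ)) / (Real.sqrt 2 : ℂ)
    else ((g (j, i) : ℂ) - Complex.I * (g (i, j) : ℂ)) / (Real.sqrt 2 : ℂ)

/-- The law of an `N × N` GUE matrix, normalized so that each entry has `E |X i j| ^ 2 = 1 / N`:
the coordinates are independent centered real Gaussians of variance `1 / N`. -/
def gueLaw (N : ℕ) : Measure (Matrix (Fin N) (Fin N) ℂ) :=
  (Measure.pi fun _ : Fin N × Fin N => gaussianReal 0 ((N : NNReal)⁻¹)).map (hermitianOfCoords N)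

/-- The law of `exp (i θ) (a X + i b Y)` for independent GUE matrices `X` and `Y`. -/
def rotatedEllipticLaw (N : ℕ) (θ a b : ℝ) : Measure (Matrix (Fin N) (Fin N) ℂ) :=
  ((gueLaw N).prod (gueLaw N)).map fun p =>
    Complex.exp (Complex.I * θ) • ((a : ℂ) • p.1 + (Complex.I * (b : ℂ)) • p.2)

/-- `Z` is a rotated elliptic random matrix with variance parameter `s` and covariance
parameter `τ`. -/
structure IsRotatedElliptic {Ω : Type*} [MeasurableSpace Ω] (P : Measure Ω) {N : ℕ}
    (Z : Ω → Matrix (Fin N) (Fin N) ℂ) (s : ℝ) (τ : ℂ) : Prop where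
  /-- `Z` has the distribution of `exp (i θ) (a X + i b Y)`, with `a`, `b` not both zero. -/
  hasLaw : ∃ θ a b : ℝ, (a ≠ 0 ∨ b ≠ 0) ∧ HasLaw Z (rotatedEllipticLaw N θ a b) P
  variance_eq : (s : ℂ) = ∫ ω, (1 / (N : ℂ)) * ((Z ω).conjTranspose * Z ω).trace ∂P
  covariance_eq : τ = (∫ ω, (1 / (N : ℂ)) * ((Z ω).conjTranspose * Z ω).trace ∂P)
      - ∫ ω, (1 / (N : ℂ)) * (Z ω ^ 2).trace ∂P

/-- The heat operator `exp (c ∂² / ∂z²)` on polynomials, as a terminating power series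
(the terms with `2 * k > natDegree p` vanish). -/
def heatOp (c : ℂ) (p : Polynomial ℂ) : Polynomial ℂ :=
  ∑ k ∈ Finset.range (p.natDegree + 1),
    (c ^ k / (Nat.factorial k : ℂ)) • (Polynomial.derivative^[2 * k] p)

end

/-! Conditioning on `X₀ = A` reduces the claim to a fixed matrix `B = z - A`. There `|det (B - Z)|²`
is a polynomial, `det (B - X) * det (B' - Y)`, evaluated at the complex Gaussian vector `(Z, conj
Z)`, with `B'` the entrywise conjugate of `B`. By Wick's formula the mean of a polynomial `f` in a
centered Gaussian vector of covariance `C` (no conjugation) is the value at the origin of `exp (Δ_C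
/ 2) f`, where `Δ_C = ∑ C a b ∂ₐ ∂_b`. Hence two Gaussian vectors give `f` the same mean as soon as
their operators agree on `f` itself (`gaussian_functional_eq`).

The mixed block of the covariance depends only on `s`; passing from `τ₀` to `τ` changes the `ZZ`
block by a multiple of `swapCov`, which stands for `∑ ∂ᵢⱼ ∂ⱼᵢ`. On a determinant this operator
equals `-∑ ∂ᵢᵢ ∂ⱼⱼ` (`Derivation.map_map_det_swap`), the operator of a scalar Gaussian matrix `g •
1`. So the change of `τ` can be traded for a Gaussian shift of `z` by `β g₀`, `β² = τ - τ₀`, in the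
first factor, and for an independent conjugate shift in the second (`covLaplacian_detPairPoly_eq`,
`integral_detPairPoly_eq`). Averaging over such a shift is the heat operator (`eval_heatOp`), and
independence of the two shifts makes the average a squared modulus again. -/

noncomputable section

open Finset MvPolynomial

/-! ### Second derivatives of determinants -/

section Determinant

variable {R A n : Type*} [CommRing R] [CommRing A] [Algebra R A] [Fintype n] [DecidableEq n]

theorem Derivation.map_finset_prod {ι : Type*} [DecidableEq ι] (D : Derivation R A A)
    (s : Finset ι) (f : ι → A) :
    D (∏ i ∈ s, f i) = ∑ i ∈ s, D (f i) * ∏ j ∈ s.erase i, f j := by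
  induction s using Finset.induction_on with
  | empty => simp
  | insert a s ha ih =>
    rw [prod_insert ha, D.leibniz, ih, sum_insert ha, erase_insert ha, smul_eq_mul, smul_eq_mul,
      mul_sum, add_comm, mul_comm (∏ i ∈ s, f i)]
    congr 1
    refine sum_congr rfl fun i hi => ?_
    have hia : i ≠ a := fun h => ha (h ▸ hi)
    rw [erase_insert_of_ne hia.symm, prod_insert (fun h => ha (mem_of_mem_erase h))]
    ring

theorem Derivation.map_det (D : Derivation R A A) (M : Matrix n n A) :
    D M.det = ∑ r, (M.updateCol r fun i => D (M i r)).det := by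
  simp only [Matrix.det_apply, map_sum, Units.smul_def, map_zsmul]
  rw [sum_comm]
  refine sum_congr rfl fun σ _ => ?_
  rw [← smul_sum, D.map_finset_prod]
  congr 1
  refine sum_congr rfl fun r _ => ?_
  rw [← mul_prod_erase univ _ (mem_univ r)]
  congr 1
  · simp
  · refine prod_congr rfl fun j hj => ?_
    rw [Matrix.updateCol_ne (ne_of_mem_erase hj)]

/-- A derivation that, on the entries of `M`, is `-1` at `(i, j)` and zero elsewhere. -/
theorem Derivation.map_det_of_single (D : Derivation R A A) (M : Matrix n n A) (i j : n)
    (h : ∀ a b, D (M a b) = if a = i ∧ b = j then -1 else 0) :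
    D M.det = -(M.updateCol j (Pi.single i 1)).det := by
  rw [D.map_det, sum_eq_single j]
  · have : (fun a => D (M a j)) = (-1 : A) • (Pi.single i 1 : n → A) := by
      ext a
      rw [h]
      by_cases ha : a = i <;> simp [ha]
    rw [this, Matrix.det_updateCol_smul]
    simp
  · intro b _ hb
    have : (fun a => D (M a b)) = 0 := by
      ext a; rw [h]; simp [hb]
    rw [this]
    exact Matrix.det_eq_zero_of_column_eq_zero b (by simp)
  · simp

/-- Each derivative replaces a column by minus a basis vector. The two signs cancel, and a column
already replaced is constant, which gives zero when `l = j`. -/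
theorem Derivation.map_map_det_of_single (D D' : Derivation R A A) (M : Matrix n n A)
    (i j k l : n)
    (h : ∀ a b, D (M a b) = if a = i ∧ b = j then -1 else 0)
    (h' : ∀ a b, D' (M a b) = if a = k ∧ b = l then -1 else 0) :
    D' (D M.det) = if l = j then 0 else
      ((M.updateCol j (Pi.single i 1)).updateCol l (Pi.single k 1)).det := by
  rw [D.map_det_of_single M i j h, map_neg, D'.map_det, sum_eq_single l]
  · split_ifs with hlj
    · subst hlj
      rw [neg_eq_zero]
      refine Matrix.det_eq_zero_of_column_eq_zero l fun a => ?_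
      by_cases ha : a = i <;> simp [ha, Pi.single_apply]
    · have : (fun a => D' ((M.updateCol j (Pi.single i 1)) a l))
          = (-1 : A) • (Pi.single k 1 : n → A) := by
        ext a
        rw [Matrix.updateCol_ne hlj, h']
        by_cases ha : a = k <;> simp [ha]
      rw [this, Matrix.det_updateCol_smul]
      simp
  · intro b _ hb
    refine Matrix.det_eq_zero_of_column_eq_zero b fun a => ?_
    rw [Matrix.updateCol_self]
    by_cases hbj : b = j
    · subst hbj
      by_cases ha : a = i <;> simp [ha]
    · rw [Matrix.updateCol_ne hbj, h']
      simp [hb]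
  · simp

/-- The second-order identity `∂ᵢⱼ ∂ⱼᵢ det = - ∂ᵢᵢ ∂ⱼⱼ det`. -/
theorem Derivation.map_map_det_swap (D : n × n → Derivation R A A) (M : Matrix n n A)
    (h : ∀ p a b, D p (M a b) = if a = p.1 ∧ b = p.2 then -1 else 0) (i j : n) :
    D (i, j) (D (j, i) M.det) + D (i, i) (D (j, j) M.det) = 0 := by
  rw [Derivation.map_map_det_of_single _ _ M j i i j (h _) (h _),
    Derivation.map_map_det_of_single _ _ M j j i i (h _) (h _)]
  by_cases hij : j = i
  · simp [hij]
  · rw [if_neg hij, if_neg (Ne.symm hij)]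
    -- The two replaced matrices differ by exchanging columns `i` and `j`, hence the opposite signs.
    have e : (M.updateCol j (Pi.single j 1)).updateCol i (Pi.single i 1)
        = ((M.updateCol i (Pi.single j 1)).updateCol j (Pi.single i 1)).submatrix id
          (Equiv.swap i j) := by
      ext a b
      rw [Matrix.submatrix_apply, id]
      by_cases hbi : b = i
      · subst hbi
        simp
      · by_cases hbj : b = j
        · subst hbj
          simp [hbi, Ne.symm hbi]
        · rw [Equiv.swap_apply_of_ne_of_ne hbi hbj]
          simp [hbi, hbj]
    rw [e, Matrix.det_permute', Equiv.Perm.sign_swap (Ne.symm hij)]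
    simp

end Determinant

/-! ### Wick's formula from integration by parts -/

section Wick

theorem pderiv_comm {ι : Type*} (a b : ι) (f : MvPolynomial ι ℂ) :
    pderiv a (pderiv b f) = pderiv b (pderiv a f) := by
  have h : ⁅(pderiv a : Derivation ℂ (MvPolynomial ι ℂ) (MvPolynomial ι ℂ)),
      (pderiv b : Derivation ℂ (MvPolynomial ι ℂ) (MvPolynomial ι ℂ))⁆ = 0 := by
    classical
    refine MvPolynomial.derivation_ext fun i => ?_
    rw [Derivation.commutator_apply, pderiv_X, pderiv_X]
    simp only [Pi.single_apply]
    split_ifs <;> simp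
  have := congrArg (fun D => D f) h
  simpa [Derivation.commutator_apply, sub_eq_zero] using this

variable {ι : Type*} [Fintype ι]

/-- The second-order operator `∑ C a b ∂ₐ ∂_b` on polynomials. -/
def covLaplacian (C : ι → ι → ℂ) : MvPolynomial ι ℂ →ₗ[ℂ] MvPolynomial ι ℂ :=
  ∑ a, ∑ b, C a b • ((pderiv a : Derivation ℂ (MvPolynomial ι ℂ) (MvPolynomial ι ℂ)).toLinearMap ∘ₗ
    (pderiv b : Derivation ℂ (MvPolynomial ι ℂ) (MvPolynomial ι ℂ)).toLinearMap)

theorem covLaplacian_apply (C : ι → ι → ℂ) (f : MvPolynomial ι ℂ) :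
    covLaplacian C f = ∑ a, ∑ b, C a b • pderiv a (pderiv b f) := by
  simp [covLaplacian, LinearMap.sum_apply]

theorem covLaplacian_pderiv (C : ι → ι → ℂ) (c : ι) (f : MvPolynomial ι ℂ) :
    covLaplacian C (pderiv c f) = pderiv c (covLaplacian C f) := by
  simp only [covLaplacian_apply, map_sum, Derivation.map_smul]
  refine sum_congr rfl fun a _ => sum_congr rfl fun b _ => ?_
  rw [pderiv_comm b c, pderiv_comm a c]

theorem covLaplacian_comm (C C' : ι → ι → ℂ) (f : MvPolynomial ι ℂ) :
    covLaplacian C (covLaplacian C' f) = covLaplacian C' (covLaplacian C f) := by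
  rw [covLaplacian_apply C', covLaplacian_apply C' (covLaplacian C f)]
  simp only [map_sum, map_smul, covLaplacian_pderiv]

theorem covLaplacian_pow_comm (C C' : ι → ι → ℂ) (k : ℕ) (f : MvPolynomial ι ℂ) :
    (covLaplacian C ^ k) (covLaplacian C' f) = covLaplacian C' ((covLaplacian C ^ k) f) := by
  induction k generalizing f with
  | zero => simp
  | succ k ih => rw [pow_succ, Module.End.mul_apply, covLaplacian_comm, ih, Module.End.mul_apply]

theorem covLaplacian_pow_pderiv (C : ι → ι → ℂ) (k : ℕ) (c : ι) (f : MvPolynomial ι ℂ) :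
    (covLaplacian C ^ k) (pderiv c f) = pderiv c ((covLaplacian C ^ k) f) := by
  induction k generalizing f with
  | zero => simp
  | succ k ih => rw [pow_succ, Module.End.mul_apply, covLaplacian_pderiv, ih, Module.End.mul_apply]

/-- Agreement at the single polynomial `f` propagates to all powers because the two operators
commute. -/
theorem covLaplacian_pow_eq (C C' : ι → ι → ℂ) (f : MvPolynomial ι ℂ)
    (h : covLaplacian C f = covLaplacian C' f) (k : ℕ) :
    (covLaplacian C ^ k) f = (covLaplacian C' ^ k) f := by
  induction k with
  | zero => simp
  | succ k ih =>
    rw [pow_succ, Module.End.mul_apply, h, covLaplacian_pow_comm, ih, pow_succ',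
      Module.End.mul_apply]

/-- The commutator of the operator with multiplication by `X c`; symmetry of `C` merges the two
cross terms into the factor 2. -/
theorem covLaplacian_X_mul (C : ι → ι → ℂ) (hC : ∀ a b, C a b = C b a) (c : ι)
    (f : MvPolynomial ι ℂ) :
    covLaplacian C (X c * f) = X c * covLaplacian C f + (2 : ℂ) • ∑ b, C c b • pderiv b f := by
  classical
  have key : ∀ a b, C a b • pderiv a (pderiv b (X c * f))
      = X c * (C a b • pderiv a (pderiv b f)) + ((if a = c then C c b • pderiv b f else 0)
        + (if b = c then C c a • pderiv a f else 0)) := by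
    intro a b
    have e : ∀ d, (pderiv d (X c : MvPolynomial ι ℂ)) = if d = c then 1 else 0 := by
      intro d; rw [pderiv_X, Pi.single_apply]; simp [eq_comm]
    rw [pderiv_mul, map_add, pderiv_mul, pderiv_mul, e, e]
    have e0 : pderiv a (if b = c then (1 : MvPolynomial ι ℂ) else 0) = 0 := by
      split_ifs <;> simp
    rw [e0]
    by_cases ha : a = c <;> by_cases hb : b = c <;>
      simp [ha, hb, smul_add, hC c, add_comm, add_assoc]
  simp only [covLaplacian_apply, key, sum_add_distrib, mul_sum, smul_sum]
  rw [sum_comm (f := fun a b => if a = c then C c b • pderiv b f else 0)]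
  simp [two_smul, sum_add_distrib]

theorem covLaplacian_pow_X_mul (C : ι → ι → ℂ) (hC : ∀ a b, C a b = C b a) (c : ι)
    (f : MvPolynomial ι ℂ) (k : ℕ) :
    (covLaplacian C ^ (k + 1)) (X c * f) = X c * (covLaplacian C ^ (k + 1)) f
      + (2 * (k + 1) : ℂ) • (covLaplacian C ^ k) (∑ b, C c b • pderiv b f) := by
  induction k generalizing f with
  | zero => simp [covLaplacian_X_mul C hC]
  | succ k ih =>
    rw [pow_succ' _ (k + 1), Module.End.mul_apply, ih, map_add, covLaplacian_X_mul C hC,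
      Module.End.mul_apply, map_smul, ← Module.End.mul_apply, ← pow_succ', add_assoc]
    congr 1
    simp only [map_sum, map_smul, covLaplacian_pow_pderiv, covLaplacian_pderiv]
    simp only [pow_succ', Module.End.mul_apply]
    rw [← add_smul]
    congr 1
    push_cast
    ring

/-- Partial sums of `exp (Δ / 2) f` evaluated at the origin. -/
def wickSum (C : ι → ι → ℂ) (n : ℕ) (f : MvPolynomial ι ℂ) : ℂ :=
  ∑ k ∈ range n, (1 / (2 ^ k * (k.factorial : ℂ))) * constantCoeff ((covLaplacian C ^ k) f)

theorem wickSum_add (C : ι → ι → ℂ) (n : ℕ) (f g : MvPolynomial ι ℂ) :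
    wickSum C n (f + g) = wickSum C n f + wickSum C n g := by
  simp [wickSum, mul_add, sum_add_distrib]

theorem wickSum_smul (C : ι → ι → ℂ) (n : ℕ) (c : ℂ) (f : MvPolynomial ι ℂ) :
    wickSum C n (c • f) = c * wickSum C n f := by
  simp only [wickSum, map_smul, constantCoeff_smul, smul_eq_mul, mul_sum]
  exact sum_congr rfl fun k _ => by ring

theorem wickSum_sum {κ : Type*} (s : Finset κ) (C : ι → ι → ℂ) (n : ℕ) (f : κ → MvPolynomial ι ℂ) :
    wickSum C n (∑ b ∈ s, f b) = ∑ b ∈ s, wickSum C n (f b) := by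
  simp only [wickSum, map_sum, mul_sum]
  exact sum_comm

/-- The constant coefficient kills `X c * _`, leaving only the commutator, whose factor `2 (k + 1)`
turns the weight of index `k + 1` into that of index `k`. Thus Wick sums obey the same recursion as
a Gaussian expectation. -/
theorem wickSum_X_mul (C : ι → ι → ℂ) (hC : ∀ a b, C a b = C b a) (n : ℕ) (c : ι)
    (f : MvPolynomial ι ℂ) :
    wickSum C (n + 1) (X c * f) = wickSum C n (∑ b, C c b • pderiv b f) := by
  rw [wickSum, sum_range_succ', wickSum]
  simp only [covLaplacian_pow_X_mul C hC]
  simp only [map_add, map_mul, constantCoeff_X, zero_mul, zero_add, constantCoeff_smul,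
    smul_eq_mul, pow_zero, Module.End.one_apply, mul_zero, add_zero]
  refine sum_congr rfl fun k _ => ?_
  rw [Nat.factorial_succ]
  have h1 : (k.factorial : ℂ) ≠ 0 := by exact_mod_cast k.factorial_ne_zero
  have h2 : (k + 1 : ℂ) ≠ 0 := by exact_mod_cast k.succ_ne_zero
  push_cast
  field_simp
  ring

/-- A normalized linear functional on polynomials satisfying the Gaussian integration by parts
formula is given by Wick's formula. -/
theorem eventually_eq_wickSum (C : ι → ι → ℂ) (hC : ∀ a b, C a b = C b a)
    (G : MvPolynomial ι ℂ →ₗ[ℂ] ℂ) (h1 : G 1 = 1)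
    (hG : ∀ c f, G (X c * f) = ∑ b, C c b * G (pderiv b f)) (f : MvPolynomial ι ℂ) :
    ∀ᶠ n in Filter.atTop, G f = wickSum C n f := by
  classical
  -- Integration by parts lowers the degree by two. Working with "eventually in `n`" avoids tracking
  -- where the series terminates.
  have hmon : ∀ d : ℕ, ∀ m : ι →₀ ℕ, m.degree = d →
      ∀ᶠ n in Filter.atTop, G (monomial m 1) = wickSum C n (monomial m 1) := by
    intro d
    induction d using Nat.strong_induction_on with
    | _ d ih =>
    intro m hm
    by_cases hm0 : m = 0
    · subst hm0
      filter_upwards [Filter.eventually_ge_atTop 1] with n hn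
      obtain ⟨n, rfl⟩ := Nat.exists_eq_add_of_le' hn
      have e : (monomial 0 1 : MvPolynomial ι ℂ) = 1 := rfl
      rw [e, h1, wickSum, sum_range_succ', sum_eq_zero]
      · simp
      · intro k _
        have : covLaplacian C 1 = 0 := by simp [covLaplacian_apply]
        rw [pow_succ (covLaplacian C), Module.End.mul_apply, this]
        simp
    · obtain ⟨c, hc⟩ : ∃ c, m c ≠ 0 := by
        by_contra! h
        exact hm0 (Finsupp.ext h)
      obtain ⟨m', rfl⟩ : ∃ m', m = m' + Finsupp.single c 1 :=
        ⟨m - Finsupp.single c 1, (tsub_add_cancel_of_le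
          (Finsupp.single_le_iff.2 (Nat.one_le_iff_ne_zero.2 hc))).symm⟩
      have hX : (monomial (m' + Finsupp.single c 1) 1 : MvPolynomial ι ℂ)
          = X c * monomial m' 1 := by
        rw [X, monomial_mul, add_comm, mul_one]
      have hdeg : m'.degree + 1 = d := by
        rw [← hm, map_add, Finsupp.degree_single]
      have hb : ∀ b, ∀ᶠ n in Filter.atTop,
          G (pderiv b (monomial m' 1)) = wickSum C n (pderiv b (monomial m' 1)) := by
        intro b
        by_cases hmb : m' b = 0
        · refine Filter.Eventually.of_forall fun n => ?_
          have : pderiv b (monomial m' (1 : ℂ)) = 0 := by simp [pderiv_monomial, hmb]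
          rw [this]
          simp [wickSum]
        · have e : pderiv b (monomial m' (1 : ℂ))
              = (m' b : ℂ) • monomial (m' - Finsupp.single b 1) 1 := by
            rw [pderiv_monomial, smul_monomial]
            simp
          have hle : Finsupp.single b 1 ≤ m' :=
            Finsupp.single_le_iff.2 (Nat.one_le_iff_ne_zero.2 hmb)
          have hd : (m' - Finsupp.single b 1).degree + 1 = m'.degree := by
            conv_rhs => rw [← tsub_add_cancel_of_le hle]
            rw [map_add, Finsupp.degree_single]
          filter_upwards [ih _ (by omega) _ (rfl : (m' - Finsupp.single b 1).degree = _)]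
            with n hn
          rw [e, map_smul, wickSum_smul, hn, smul_eq_mul]
      rw [hX]
      have hall := Filter.eventually_all.2 hb
      rw [← Filter.map_add_atTop_eq_nat 1, Filter.eventually_map]
      filter_upwards [hall] with n hn
      rw [wickSum_X_mul C hC, hG, wickSum_sum]
      exact sum_congr rfl fun b _ => by rw [wickSum_smul, hn]
  induction f using MvPolynomial.induction_on' with
  | monomial m a =>
    filter_upwards [hmon _ m rfl] with n hn
    have e : monomial m a = a • monomial m (1 : ℂ) := by simp [smul_monomial]
    rw [e, map_smul, wickSum_smul, hn, smul_eq_mul]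
  | add p q hp hq =>
    filter_upwards [hp, hq] with n hn₁ hn₂
    rw [map_add, wickSum_add, hn₁, hn₂]

/-- Two Gaussian functionals agree on every polynomial on which the associated Laplacians agree. -/
theorem gaussian_functional_eq {C C' : ι → ι → ℂ} (hC : ∀ a b, C a b = C b a)
    (hC' : ∀ a b, C' a b = C' b a)
    {G G' : MvPolynomial ι ℂ →ₗ[ℂ] ℂ} (h1 : G 1 = 1) (h1' : G' 1 = 1)
    (hG : ∀ c f, G (X c * f) = ∑ b, C c b * G (pderiv b f))
    (hG' : ∀ c f, G' (X c * f) = ∑ b, C' c b * G' (pderiv b f))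
    (f : MvPolynomial ι ℂ) (h : covLaplacian C f = covLaplacian C' f) : G f = G' f := by
  obtain ⟨n, hn, hn'⟩ := ((eventually_eq_wickSum C hC G h1 hG f).and
    (eventually_eq_wickSum C' hC' G' h1' hG' f)).exists
  rw [hn, hn', wickSum, wickSum]
  simp only [covLaplacian_pow_eq C C' f h]

end Wick

/-! ### Moments of a real Gaussian -/

section Moments

variable (v : NNReal)

/-- Repeated differentiation of `M' = v t M`; at `t = 0` it becomes the moment recursion. -/
theorem iteratedDeriv_gaussian_mgf (n : ℕ) (t : ℝ) :
    iteratedDeriv (n + 2) (fun t : ℝ => Real.exp (v * t ^ 2 / 2)) t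
      = v * t * iteratedDeriv (n + 1) (fun t : ℝ => Real.exp (v * t ^ 2 / 2)) t
        + (n + 1) * v * iteratedDeriv n (fun t : ℝ => Real.exp (v * t ^ 2 / 2)) t := by
  set M : ℝ → ℝ := fun t => Real.exp (v * t ^ 2 / 2) with hM
  have hc : ContDiff ℝ ⊤ M := by
    rw [hM]; fun_prop
  have hd : ∀ (k : ℕ) (t : ℝ), HasDerivAt (iteratedDeriv k M) (iteratedDeriv (k + 1) M t) t := by
    intro k t
    rw [iteratedDeriv_succ]
    exact (hc.differentiable_iteratedDeriv k (WithTop.coe_lt_top _) t).hasDerivAt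
  have h1 : ∀ t, iteratedDeriv 1 M t = v * t * M t := by
    intro t
    rw [iteratedDeriv_one]
    have : HasDerivAt M (Real.exp (v * t ^ 2 / 2) * (v * (2 * t) / 2)) t := by
      refine HasDerivAt.exp (((HasDerivAt.const_mul (v : ℝ) ?_)).div_const 2)
      simpa using hasDerivAt_pow 2 t
    rw [this.deriv]
    ring
  induction n generalizing t with
  | zero =>
    have e : iteratedDeriv 1 M = fun t => v * t * M t := funext h1
    have h0 : HasDerivAt M (iteratedDeriv 1 M t) t := by simpa using hd 0 t
    have h2 := (((hasDerivAt_id t).const_mul (v : ℝ)).mul h0).unique (e ▸ hd 1 t : HasDerivAt _ _ t)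
    simp only [iteratedDeriv_zero]
    rw [show 0 + 2 = 1 + 1 from rfl, ← h2]
    simp
    ring
  | succ n ih =>
    have e : iteratedDeriv (n + 2) M = fun t => v * t * iteratedDeriv (n + 1) M t
        + (n + 1) * v * iteratedDeriv n M t := funext ih
    have h2 := ((((hasDerivAt_id t).const_mul (v : ℝ)).mul (hd (n + 1) t)).add
      ((hd n t).const_mul ((n + 1) * (v : ℝ)))).unique (e ▸ hd (n + 2) t : HasDerivAt _ _ t)
    rw [show n + 1 + 2 = n + 2 + 1 from rfl, ← h2]
    simp
    ring

/-- The moments of the centered Gaussian of variance `v`. -/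
def gaussianMoment (n : ℕ) : ℂ := ∫ x, (x : ℂ) ^ n ∂gaussianReal 0 v

theorem gaussianMoment_eq (n : ℕ) :
    gaussianMoment v n = (iteratedDeriv n (fun t : ℝ => Real.exp (v * t ^ 2 / 2)) 0 : ℝ) := by
  have h := iteratedDeriv_mgf_zero (X := id) (μ := gaussianReal 0 v)
    (by simp [integrableExpSet_id_gaussianReal]) n
  rw [mgf_id_gaussianReal] at h
  simp only [zero_mul, zero_add] at h
  rw [h, gaussianMoment, ← integral_complex_ofReal]
  simp

theorem gaussianMoment_zero : gaussianMoment v 0 = 1 := by simp [gaussianMoment]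

theorem gaussianMoment_one : gaussianMoment v 1 = 0 := by
  simp only [gaussianMoment, pow_one]
  rw [integral_complex_ofReal, integral_id_gaussianReal, Complex.ofReal_zero]

theorem gaussianMoment_add_two (n : ℕ) :
    gaussianMoment v (n + 2) = v * (n + 1) * gaussianMoment v n := by
  rw [gaussianMoment_eq, gaussianMoment_eq, iteratedDeriv_gaussian_mgf]
  push_cast
  ring

theorem gaussianMoment_succ (n : ℕ) :
    gaussianMoment v (n + 1) = v * (n * gaussianMoment v (n - 1)) := by
  cases n with
  | zero => simp [gaussianMoment_one]
  | succ n => rw [gaussianMoment_add_two, Nat.add_sub_cancel]; push_cast; ring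

theorem integrable_pow_gaussianReal (n : ℕ) :
    Integrable (fun x : ℝ => (x : ℂ) ^ n) (gaussianReal 0 v) := by
  have h : MemLp (fun x : ℝ => (x : ℂ)) n (gaussianReal 0 v) :=
    (memLp_id_gaussianReal' (n : ENNReal) (by simp)).ofReal
  have := h.integrable_norm_pow'
  refine (integrable_norm_iff (by fun_prop)).1 ?_
  simpa [norm_pow] using this

end Moments

/-! ### Gaussian integration by parts for polynomials -/

section Stein

variable {κ : Type*} [Fintype κ] (v : NNReal)

/-- The law of a family of independent centered real Gaussians of variance `v`. -/
abbrev gaussianPi (κ : Type*) [Fintype κ] (v : NNReal) : Measure (κ → ℝ) :=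
  Measure.pi fun _ => gaussianReal 0 v

theorem integrable_eval_gaussianPi (f : MvPolynomial κ ℂ) :
    Integrable (fun g : κ → ℝ => eval (fun k => (g k : ℂ)) f) (gaussianPi κ v) := by
  induction f using MvPolynomial.induction_on' with
  | monomial m a =>
    simp only [eval_monomial, Finsupp.prod_fintype _ _ (fun _ => pow_zero _)]
    exact (Integrable.fintype_prod (f := fun k (x : ℝ) => (x : ℂ) ^ m k)
      fun k => integrable_pow_gaussianReal v (m k)).const_mul a
  | add p q hp hq => simpa using! hp.add hq

/-- Expectation of a polynomial in independent Gaussians. -/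
def gaussianExpect : MvPolynomial κ ℂ →ₗ[ℂ] ℂ where
  toFun f := ∫ g, eval (fun k => ((g k : ℝ) : ℂ)) f ∂gaussianPi κ v
  map_add' p q := by
    simp only [map_add]
    exact integral_add (integrable_eval_gaussianPi v p) (integrable_eval_gaussianPi v q)
  map_smul' c p := by
    simp only [smul_eval, RingHom.id_apply, smul_eq_mul]
    exact integral_const_mul c _

theorem gaussianExpect_apply (f : MvPolynomial κ ℂ) :
    gaussianExpect v f = ∫ g, eval (fun k => ((g k : ℝ) : ℂ)) f ∂gaussianPi κ v := rfl

theorem gaussianExpect_monomial (m : κ →₀ ℕ) (a : ℂ) :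
    gaussianExpect v (monomial m a) = a * ∏ k, gaussianMoment v (m k) := by
  simp only [gaussianExpect_apply, eval_monomial, Finsupp.prod_fintype _ _ (fun _ => pow_zero _)]
  rw [integral_const_mul]
  congr 1
  exact integral_fintype_prod_eq_prod (fun k (x : ℝ) => (x : ℂ) ^ m k)

theorem gaussianExpect_one : gaussianExpect v (1 : MvPolynomial κ ℂ) = 1 := by
  simp [gaussianExpect_apply]

/-- On monomials the expectation factors over coordinates, so only the one-dimensional recursion
`gaussianMoment_succ` in coordinate `k` is needed. -/
theorem gaussianExpect_X_mul (k : κ) (f : MvPolynomial κ ℂ) :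
    gaussianExpect v (X k * f) = v * gaussianExpect v (pderiv k f) := by
  classical
  induction f using MvPolynomial.induction_on' with
  | monomial m a =>
    rw [X, monomial_mul, one_mul, pderiv_monomial, gaussianExpect_monomial,
      gaussianExpect_monomial, ← mul_prod_erase univ _ (mem_univ k),
      ← mul_prod_erase univ (fun j => gaussianMoment v ((m - Finsupp.single k 1 : κ →₀ ℕ) j))
        (mem_univ k)]
    have e1 : ∏ j ∈ univ.erase k, gaussianMoment v ((Finsupp.single k 1 + m : κ →₀ ℕ) j)
        = ∏ j ∈ univ.erase k, gaussianMoment v (m j) :=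
      prod_congr rfl fun j hj => by
        simp [(ne_of_mem_erase hj).symm]
    have e2 : ∏ j ∈ univ.erase k, gaussianMoment v ((m - Finsupp.single k 1 : κ →₀ ℕ) j)
        = ∏ j ∈ univ.erase k, gaussianMoment v (m j) :=
      prod_congr rfl fun j hj => by
        simp [(ne_of_mem_erase hj).symm]
    rw [e1, e2]
    simp only [Finsupp.add_apply, Finsupp.tsub_apply, Finsupp.single_eq_same]
    rw [add_comm 1, gaussianMoment_succ]
    ring
  | add p q hp hq => rw [mul_add, map_add, hp, hq, map_add, map_add, mul_add]

variable {ι : Type*}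

/-- The complex Gaussian vector with coordinates `∑ k, M k a * g k`. -/
def linearForms (M : κ → ι → ℂ) : MvPolynomial ι ℂ →ₐ[ℂ] MvPolynomial κ ℂ :=
  aeval fun a => ∑ k, M k a • X k

theorem pderiv_linearForms [Fintype ι] (M : κ → ι → ℂ) (k : κ) (f : MvPolynomial ι ℂ) :
    pderiv k (linearForms M f) = ∑ a, M k a • linearForms M (pderiv a f) := by
  classical
  induction f using MvPolynomial.induction_on with
  | C c => simp [linearForms]
  | add p q hp hq => simp [hp, hq, sum_add_distrib]
  | mul_X p a hp =>
    have e : pderiv k (linearForms M (X a)) = C (M k a) := by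
      simp only [linearForms, aeval_X, map_sum, Derivation.map_smul, pderiv_X, Pi.single_apply]
      simp [smul_eq_C_mul]
    rw [map_mul, pderiv_mul, hp, e]
    simp only [pderiv_mul, map_add, map_mul, smul_add, sum_add_distrib, sum_mul, smul_mul_assoc]
    congr 1
    rw [sum_eq_single a]
    · simp [smul_eq_C_mul, mul_comm]
    · intro b _ hb
      simp [pderiv_X_of_ne hb.symm]
    · simp

/-- The covariance (without conjugation) of a complex Gaussian vector. -/
def gaussianCov (v : NNReal) (M : κ → ι → ℂ) (a b : ι) : ℂ := v * ∑ k, M k a * M k b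

theorem gaussianCov_symm (M : κ → ι → ℂ) (a b : ι) :
    gaussianCov v M a b = gaussianCov v M b a := by
  simp [gaussianCov, mul_comm]

/-- Integration by parts in the real coordinates combined with the chain rule; this is the
hypothesis required by `gaussian_functional_eq`. -/
theorem gaussianExpect_linearForms_X_mul [Fintype ι] (M : κ → ι → ℂ) (a : ι)
    (f : MvPolynomial ι ℂ) :
    gaussianExpect v (linearForms M (X a * f))
      = ∑ b, gaussianCov v M a b * gaussianExpect v (linearForms M (pderiv b f)) := by
  rw [map_mul]
  have e : linearForms M (X a) = ∑ k, M k a • X k := by simp [linearForms]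
  rw [e, sum_mul, map_sum]
  simp only [smul_mul_assoc, map_smul, gaussianExpect_X_mul, pderiv_linearForms, map_sum,
    gaussianCov, smul_eq_mul, mul_sum, sum_mul]
  rw [sum_comm]
  refine sum_congr rfl fun b _ => sum_congr rfl fun k _ => ?_
  ring

theorem eval_linearForms (M : κ → ι → ℂ) (x : κ → ℂ) (f : MvPolynomial ι ℂ) :
    eval x (linearForms M f) = eval (fun a => ∑ k, M k a * x k) f := by
  rw [linearForms, ← aeval_eq_eval, ← aeval_eq_eval, ← AlgHom.comp_apply]
  congr 1
  ext a
  simp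

theorem integrable_eval_linear (M : κ → ι → ℂ) (f : MvPolynomial ι ℂ) :
    Integrable (fun g : κ → ℝ => eval (fun a => ∑ k, M k a * (g k : ℂ)) f) (gaussianPi κ v) := by
  simpa only [eval_linearForms] using integrable_eval_gaussianPi v (linearForms M f)

theorem integral_linear_mul_linear [Fintype ι] (M : κ → ι → ℂ) (a b : ι) :
    ∫ g, (∑ k, M k a * (g k : ℂ)) * (∑ k, M k b * (g k : ℂ)) ∂gaussianPi κ v
      = gaussianCov v M a b := by
  classical
  have h := gaussianExpect_linearForms_X_mul v M a (X b)
  simp only [gaussianExpect_apply, eval_linearForms] at h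
  simp only [map_mul, eval_X] at h
  rw [h, sum_eq_single b]
  · simp
  · intro c _ hc
    simp [pderiv_X_of_ne hc.symm]
  · simp

/-- Comparison of expectations of a polynomial in two complex Gaussian vectors. -/
theorem integral_gaussian_eq [Fintype ι] {κ' : Type*} [Fintype κ'] (M : κ → ι → ℂ) (M' : κ' → ι → ℂ)
    (f : MvPolynomial ι ℂ)
    (h : covLaplacian (gaussianCov v M) f = covLaplacian (gaussianCov v M') f) :
    ∫ g, eval (fun a => ∑ k, M k a * ((g k : ℝ) : ℂ)) f ∂gaussianPi κ v
      = ∫ g, eval (fun a => ∑ k, M' k a * ((g k : ℝ) : ℂ)) f ∂gaussianPi κ' v := by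
  have := gaussian_functional_eq (gaussianCov_symm v M) (gaussianCov_symm v M')
    (G := gaussianExpect v ∘ₗ (linearForms M).toLinearMap)
    (G' := gaussianExpect v ∘ₗ (linearForms M').toLinearMap)
    (by simp [gaussianExpect_one]) (by simp [gaussianExpect_one])
    (gaussianExpect_linearForms_X_mul v M) (gaussianExpect_linearForms_X_mul v M') f h
  simpa [gaussianExpect_apply, eval_linearForms] using this

end Stein

/-! ### The heat operator as a Gaussian average -/

section Heat

variable (v : NNReal)

theorem gaussianMoment_odd (k : ℕ) : gaussianMoment v (2 * k + 1) = 0 := by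
  induction k with
  | zero => exact gaussianMoment_one v
  | succ k ih => rw [show 2 * (k + 1) + 1 = 2 * k + 1 + 2 by ring, gaussianMoment_add_two, ih,
      mul_zero]

theorem gaussianMoment_even (k : ℕ) :
    gaussianMoment v (2 * k) * (2 ^ k * k.factorial) = (v : ℂ) ^ k * (2 * k).factorial := by
  induction k with
  | zero => simp [gaussianMoment_zero]
  | succ k ih =>
    rw [show 2 * (k + 1) = 2 * k + 2 by ring, gaussianMoment_add_two, Nat.factorial_succ,
      Nat.factorial_succ (2 * k + 1), Nat.factorial_succ (2 * k)]
    push_cast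
    linear_combination (v : ℂ) * (2 * k + 1) * (2 * k + 2) * ih

/-- The heat operator is convolution with a (complex multiple of a) Gaussian. -/
theorem eval_heatOp (β z : ℂ) (q : Polynomial ℂ) :
    (heatOp (v * β ^ 2 / 2) q).eval z = ∫ x, q.eval (z + β * (x : ℂ)) ∂gaussianReal 0 v := by
  -- Taylor expansion at `z`, padded with zero terms so that the even indices match the range in
  -- `heatOp` exactly; the odd moments vanish.
  have hT : ∀ x : ℝ, q.eval (z + β * (x : ℂ)) = ∑ n ∈ range (2 * (q.natDegree + 1)),
      ((Polynomial.hasseDeriv n q).eval z * β ^ n) * (x : ℂ) ^ n := by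
    intro x
    rw [add_comm, ← Polynomial.taylor_eval, Polynomial.eval_eq_sum_range'
      (n := 2 * (q.natDegree + 1)) (by rw [Polynomial.natDegree_taylor]; omega)]
    refine sum_congr rfl fun n _ => ?_
    rw [Polynomial.taylor_coeff, mul_pow]
    ring
  simp only [hT]
  rw [integral_finsetSum _ fun n _ => (integrable_pow_gaussianReal v n).const_mul _]
  simp only [integral_const_mul]
  change _ = ∑ n ∈ range (2 * (q.natDegree + 1)), _ * gaussianMoment v n
  have hs : ∀ (F : ℕ → ℂ) (d : ℕ), (∀ k, F (2 * k + 1) = 0) →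
      ∑ n ∈ range (2 * d), F n = ∑ k ∈ range d, F (2 * k) := by
    intro F d hF
    induction d with
    | zero => simp
    | succ d ih =>
      rw [show 2 * (d + 1) = 2 * d + 1 + 1 by ring, sum_range_succ, sum_range_succ, ih, hF,
        sum_range_succ, add_zero]
  rw [hs _ _ fun k => by rw [gaussianMoment_odd, mul_zero], heatOp, Polynomial.eval_finsetSum]
  refine sum_congr rfl fun k _ => ?_
  rw [Polynomial.eval_smul, smul_eq_mul, ← Polynomial.factorial_smul_hasseDeriv]
  have h3 : Polynomial.eval z (((2 * k).factorial • Polynomial.hasseDeriv (R := ℂ) (2 * k)) q)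
      = (2 * k).factorial * Polynomial.eval z (Polynomial.hasseDeriv (2 * k) q) := by
    rw [LinearMap.smul_apply, Polynomial.eval_smul, nsmul_eq_mul]
  rw [h3]
  have h1 : (k.factorial : ℂ) ≠ 0 := by exact_mod_cast k.factorial_ne_zero
  have h2 : gaussianMoment v (2 * k)
      = (v : ℂ) ^ k * (2 * k).factorial / (2 ^ k * k.factorial) := by
    rw [eq_div_iff (mul_ne_zero (by simp) h1), gaussianMoment_even]
  rw [h2, div_pow, mul_pow, ← pow_mul]
  field_simp

end Heat

/-! ### The polynomial behind the squared modulus -/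

section DetPolynomial

variable {n : Type*} [Fintype n] [DecidableEq n]

/-- The matrix `B - X`, whose variables are indexed through `e`. -/
def shiftedVarMatrix {ι : Type*} (e : n × n → ι) (B : Matrix n n ℂ) :
    Matrix n n (MvPolynomial ι ℂ) :=
  Matrix.of fun i j => C (B i j) - X (e (i, j))

theorem eval_det_shiftedVarMatrix {ι : Type*} (e : n × n → ι) (B : Matrix n n ℂ) (x : ι → ℂ) :
    eval x (shiftedVarMatrix e B).det = (B - Matrix.of fun i j => x (e (i, j))).det := by
  rw [RingHom.map_det]
  congr 1
  ext i j
  simp [shiftedVarMatrix]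

theorem pderiv_shiftedVarMatrix {n : Type*} [DecidableEq n] {ι : Type*} (e : n × n → ι)
    (he : e.Injective) (B : Matrix n n ℂ) (p : n × n) (a b : n) :
    pderiv (e p) (shiftedVarMatrix e B a b) = if a = p.1 ∧ b = p.2 then -1 else 0 := by
  classical
  rw [shiftedVarMatrix, Matrix.of_apply, map_sub, pderiv_C, pderiv_X, Pi.single_apply, zero_sub]
  simp only [he.eq_iff, Prod.ext_iff]
  split_ifs <;> simp_all

theorem pderiv_det_shiftedVarMatrix_of_notMem {ι : Type*} (e : n × n → ι) (B : Matrix n n ℂ)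
    (a : ι) (ha : ∀ p, e p ≠ a) : pderiv a (shiftedVarMatrix e B).det = 0 := by
  rw [Derivation.map_det]
  refine sum_eq_zero fun r _ => Matrix.det_eq_zero_of_column_eq_zero r fun i => ?_
  simp [shiftedVarMatrix, pderiv_X_of_ne (ha _)]

/-- The polynomial `det (B - X) * det (B' - Y)` in two matrices of variables. -/
def detPairPoly (B B' : Matrix n n ℂ) : MvPolynomial (n × n ⊕ n × n) ℂ :=
  (shiftedVarMatrix Sum.inl B).det * (shiftedVarMatrix Sum.inr B').det

theorem detPairPoly_swap_inl (B B' : Matrix n n ℂ) (i j : n) :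
    pderiv (Sum.inl (i, j)) (pderiv (Sum.inl (j, i)) (detPairPoly B B'))
      + pderiv (Sum.inl (i, i)) (pderiv (Sum.inl (j, j)) (detPairPoly B B')) = 0 := by
  have h0 : ∀ p : n × n, pderiv (Sum.inl p : n × n ⊕ n × n)
      (shiftedVarMatrix Sum.inr B').det = 0 := fun p =>
    pderiv_det_shiftedVarMatrix_of_notMem _ _ _ (by simp)
  have h := Derivation.map_map_det_swap
    (fun p => (pderiv (Sum.inl p) : Derivation ℂ (MvPolynomial (n × n ⊕ n × n) ℂ) _))
    (shiftedVarMatrix Sum.inl B) (pderiv_shiftedVarMatrix _ Sum.inl_injective B) i j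
  simp only [detPairPoly, pderiv_mul, h0, mul_zero, add_zero]
  rw [← add_mul, h, zero_mul]

theorem detPairPoly_swap_inr (B B' : Matrix n n ℂ) (i j : n) :
    pderiv (Sum.inr (i, j)) (pderiv (Sum.inr (j, i)) (detPairPoly B B'))
      + pderiv (Sum.inr (i, i)) (pderiv (Sum.inr (j, j)) (detPairPoly B B')) = 0 := by
  have h0 : ∀ p : n × n, pderiv (Sum.inr p : n × n ⊕ n × n)
      (shiftedVarMatrix Sum.inl B).det = 0 := fun p =>
    pderiv_det_shiftedVarMatrix_of_notMem _ _ _ (by simp)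
  have h := Derivation.map_map_det_swap
    (fun p => (pderiv (Sum.inr p) : Derivation ℂ (MvPolynomial (n × n ⊕ n × n) ℂ) _))
    (shiftedVarMatrix Sum.inr B') (pderiv_shiftedVarMatrix _ Sum.inr_injective B') i j
  simp only [detPairPoly, pderiv_mul, h0, zero_mul, zero_add]
  rw [← mul_add, h, mul_zero]

/-- Covariance `E H i j * H k l` of a GUE-type Hermitian matrix `H`. -/
def swapCov (p q : n × n) : ℂ := if p.1 = q.2 ∧ p.2 = q.1 then 1 else 0

/-- Covariance of the scalar matrix `g • 1`. -/
def diagCov (p q : n × n) : ℂ := if p.1 = p.2 ∧ q.1 = q.2 then 1 else 0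

theorem sum_swapCov_add_diagCov {E : Type*} [AddCommGroup E] [Module ℂ E]
    (F : n × n → n × n → E) (hF : ∀ i j, F (i, j) (j, i) + F (i, i) (j, j) = 0) :
    ∑ p, ∑ q, (swapCov p q + diagCov p q) • F p q = 0 := by
  have h1 : ∑ p, ∑ q, swapCov p q • F p q = ∑ i, ∑ j, F (i, j) (j, i) := by
    rw [Fintype.sum_prod_type]
    refine sum_congr rfl fun i _ => sum_congr rfl fun j _ => ?_
    rw [sum_eq_single (j, i)]
    · simp [swapCov]
    · rintro ⟨k, l⟩ _ h
      rw [swapCov, if_neg, zero_smul]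
      rintro ⟨h1, h2⟩
      exact h (by simp_all)
    · simp
  have h2 : ∑ p, ∑ q, diagCov p q • F p q = ∑ i, ∑ j, F (i, i) (j, j) := by
    rw [Fintype.sum_prod_type]
    refine sum_congr rfl fun i _ => ?_
    rw [sum_eq_single i]
    · rw [Fintype.sum_prod_type]
      refine sum_congr rfl fun j _ => ?_
      rw [sum_eq_single j]
      · simp [diagCov]
      · intro k _ hk
        simp [diagCov, hk.symm]
      · simp
    · intro k _ hk
      simp [diagCov, hk.symm]
    · simp
  simp only [add_smul, sum_add_distrib, h1, h2]
  simp only [← sum_add_distrib, hF, sum_const_zero]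

/-- The operator with coefficients `swapCov + diagCov`, in either block of variables, annihilates
`detPairPoly`, since the other determinant is constant in that block. -/
theorem covLaplacian_detPairPoly_eq (K K' : n × n ⊕ n × n → n × n ⊕ n × n → ℂ) (δ δ' : ℂ)
    (h₁₁ : ∀ p q, K (.inl p) (.inl q) = K' (.inl p) (.inl q) + δ * (swapCov p q + diagCov p q))
    (h₁₂ : ∀ p q, K (.inl p) (.inr q) = K' (.inl p) (.inr q))
    (h₂₁ : ∀ p q, K (.inr p) (.inl q) = K' (.inr p) (.inl q))
    (h₂₂ : ∀ p q, K (.inr p) (.inr q) = K' (.inr p) (.inr q) + δ' * (swapCov p q + diagCov p q))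
    (B B' : Matrix n n ℂ) :
    covLaplacian K (detPairPoly B B') = covLaplacian K' (detPairPoly B B') := by
  have e₁ := sum_swapCov_add_diagCov
    (fun p q => pderiv (Sum.inl p) (pderiv (Sum.inl q) (detPairPoly B B')))
    (detPairPoly_swap_inl B B')
  have e₂ := sum_swapCov_add_diagCov
    (fun p q => pderiv (Sum.inr p) (pderiv (Sum.inr q) (detPairPoly B B')))
    (detPairPoly_swap_inr B B')
  simp only [covLaplacian_apply, Fintype.sum_sum_type, h₁₁, h₁₂, h₂₁, h₂₂, sum_add_distrib,
    add_smul _ (_ * _), mul_smul δ, mul_smul δ', ← smul_sum, e₁, e₂, smul_zero, add_zero]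

end DetPolynomial

/-! ### Covariance of the GUE entries -/

section Herm

/-- The coefficient of the coordinate `p` in the entry `q` of `hermitianOfCoords`. -/
def hermCoeff (N : ℕ) (p q : Fin N × Fin N) : ℂ := hermitianOfCoords N (Pi.single p 1) q.1 q.2

theorem hermitianOfCoords_apply (N : ℕ) (g : Fin N × Fin N → ℝ) (q : Fin N × Fin N) :
    hermitianOfCoords N g q.1 q.2 = ∑ p, hermCoeff N p q * (g p : ℂ) := by
  obtain ⟨i, j⟩ := q
  have hs : ∀ r, ∑ p, ((Pi.single p (1 : ℝ) : Fin N × Fin N → ℝ) r : ℂ) * (g p : ℂ) = g r := by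
    intro r
    rw [sum_eq_single r]
    · simp
    · intro p _ hp
      simp [hp.symm]
    · simp
  simp only [hermCoeff, hermitianOfCoords, Matrix.of_apply]
  split_ifs with h1 h2
  · rw [hs]
  · rw [← hs (i, j), ← hs (j, i), mul_sum, ← sum_add_distrib, sum_div]
    exact sum_congr rfl fun p _ => by ring
  · rw [← hs (i, j), ← hs (j, i), mul_sum, ← sum_sub_distrib, sum_div]
    exact sum_congr rfl fun p _ => by ring

theorem conj_hermCoeff (N : ℕ) (p : Fin N × Fin N) (i j : Fin N) :
    star (hermCoeff N p (i, j)) = hermCoeff N p (j, i) := by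
  simp only [hermCoeff, hermitianOfCoords, Matrix.of_apply]
  rcases lt_trichotomy i j with h | h | h
  · simp [h.ne, h.ne', h, h.not_gt, sub_eq_add_neg]
  · simp [h]
  · simp [h.ne, h.ne', h, h.not_gt, sub_eq_add_neg]

theorem sum_hermCoeff_mul (N : ℕ) (q r : Fin N × Fin N) :
    ∑ p, hermCoeff N p q * hermCoeff N p r = swapCov q r := by
  obtain ⟨i, j⟩ := q
  obtain ⟨k, l⟩ := r
  have hs : ∀ r, ∑ p, ((Pi.single p (1 : ℝ) : Fin N × Fin N → ℝ) r : ℂ) * hermCoeff N p (k, l)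
      = hermCoeff N r (k, l) := by
    intro r
    rw [sum_eq_single r]
    · simp
    · intro p _ hp
      simp [hp.symm]
    · simp
  have h2 : ((Real.sqrt 2 : ℝ) : ℂ) * ((Real.sqrt 2 : ℝ) : ℂ) = 2 := by
    rw [← Complex.ofReal_mul, Real.mul_self_sqrt (by norm_num)]; norm_num
  have h0 : ((Real.sqrt 2 : ℝ) : ℂ) ≠ 0 := by
    intro h; rw [h] at h2; norm_num at h2
  have hI := Complex.I_mul_I
  have expand : ∑ p, hermCoeff N p (i, j) * hermCoeff N p (k, l)
      = if i = j then hermCoeff N (i, i) (k, l) else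
        if i < j then (hermCoeff N (i, j) (k, l) + Complex.I * hermCoeff N (j, i) (k, l)) /
          (Real.sqrt 2 : ℂ) else
          (hermCoeff N (j, i) (k, l) - Complex.I * hermCoeff N (i, j) (k, l)) /
          (Real.sqrt 2 : ℂ) := by
    conv_lhs =>
      enter [2, p]
      rw [hermCoeff, hermitianOfCoords, Matrix.of_apply]
    split_ifs with h1 h2
    · rw [hs]
    · rw [← hs (i, j), ← hs (j, i), mul_sum, ← sum_add_distrib, sum_div]
      exact sum_congr rfl fun p _ => by ring
    · rw [← hs (i, j), ← hs (j, i), mul_sum, ← sum_sub_distrib, sum_div]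
      exact sum_congr rfl fun p _ => by ring
  rw [expand]
  simp only [hermCoeff, hermitianOfCoords, Matrix.of_apply, swapCov, Pi.single_apply,
    Prod.mk.injEq]
  -- Off the diagonal, the square of an entry has covariance `(1 + I²) / 2 = 0`, while an entry
  -- times its transpose has `(1 - I²) / 2 = 1`.
  by_cases e1 : k = i ∧ l = j
  · obtain ⟨rfl, rfl⟩ := e1
    rcases lt_trichotomy k l with h | rfl | h
    · simp only [h.ne, h.ne', h]
      simp
      field_simp
      simp
    · simp
    · simp only [h.ne, h.ne', h.not_gt]
      simp
      field_simp
      simp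
  by_cases e2 : l = i ∧ k = j
  · obtain ⟨rfl, rfl⟩ := e2
    rcases lt_trichotomy k l with h | rfl | h
    · simp only [h.ne, h.ne', h, h.not_gt]
      simp
      field_simp
      linear_combination -h2 - hI
    · simp
    · simp only [h.ne, h.ne', h, h.not_gt]
      simp
      field_simp
      linear_combination -h2 - hI
  have e1' : ¬ (l = j ∧ k = i) := fun h => e1 h.symm
  have e2' : ¬ (k = j ∧ l = i) := fun h => e2 h.symm
  have e3 : ¬ (i = l ∧ j = k) := fun h => e2 ⟨h.1.symm, h.2.symm⟩
  by_cases hij : i = j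
  · subst hij
    by_cases hkl : k = l
    · subst hkl
      simp only [e1, e3, if_true, if_false, Complex.ofReal_zero]
    · simp only [hkl, e1, e2, e3, if_true, if_false, Complex.ofReal_zero]
      simp
  · by_cases hkl : k = l
    · subst hkl
      simp only [hij, e1, e1', e3, if_true, if_false, Complex.ofReal_zero]
      simp
    · simp only [hij, hkl, e1, e2, e1', e2', e3, if_false, Complex.ofReal_zero]
      simp

end Herm

/-! ### Covariances of elliptic matrices, with and without the scalar shift -/

section Elliptic

/-- The coefficients of the Gaussian coordinates in the entries of `c • X + d • Y`, for independent
GUE matrices `X` and `Y`. -/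
def ellipticCoeff (N : ℕ) (c d : ℂ) :
    (Fin N × Fin N) ⊕ (Fin N × Fin N) → Fin N × Fin N → ℂ :=
  Sum.elim (fun p q => c * hermCoeff N p q) (fun p q => d * hermCoeff N p q)

theorem sum_ellipticCoeff_mul (N : ℕ) (c d c' d' : ℂ) (p q : Fin N × Fin N) :
    ∑ k, ellipticCoeff N c d k p * ellipticCoeff N c' d' k q
      = (c * c' + d * d') * swapCov p q := by
  rw [Fintype.sum_sum_type, add_mul, ← sum_hermCoeff_mul, mul_sum, mul_sum]
  congr 1
  · exact sum_congr rfl fun k _ => mul_mul_mul_comm _ _ _ _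
  · exact sum_congr rfl fun k _ => mul_mul_mul_comm _ _ _ _

theorem star_ellipticCoeff (N : ℕ) (c d : ℂ) (k) (q : Fin N × Fin N) :
    star (ellipticCoeff N c d k q) = ellipticCoeff N (star c) (star d) k q.swap := by
  obtain ⟨i, j⟩ := q
  rcases k with k | k <;> simp [ellipticCoeff, ← conj_hermCoeff N k i j]

/-- The coefficients of a complex Gaussian vector together with its conjugate. -/
def withConj {κ σ : Type*} (E : κ → σ → ℂ) : κ → σ ⊕ σ → ℂ :=
  fun k => Sum.elim (E k) fun q => star (E k q)

/-- The coefficients of the Gaussian vector `(Z - β g₀, conj Z - conj β g₁)`, where `Z` is the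
matrix with coefficients `E` and `g₀`, `g₁` are additional independent Gaussians. -/
def withConjShift {κ n : Type*} [DecidableEq n] (E : κ → n × n → ℂ) (β : ℂ) :
    κ ⊕ Fin 2 → n × n ⊕ n × n → ℂ :=
  Sum.elim (withConj E)
    ![Sum.elim (fun q => if q.1 = q.2 then -β else 0) 0,
      Sum.elim 0 (fun q => if q.1 = q.2 then -star β else 0)]

variable (N : ℕ) (v : NNReal) (c d : ℂ) (p q : Fin N × Fin N)

theorem gaussianCov_ellipticCoeff_inl_inl :
    gaussianCov v (withConj (ellipticCoeff N c d)) (.inl p) (.inl q)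
      = v * ((c ^ 2 + d ^ 2) * swapCov p q) := by
  simp only [gaussianCov, withConj, Sum.elim_inl, sum_ellipticCoeff_mul, sq]

theorem gaussianCov_ellipticCoeff_inl_inr :
    gaussianCov v (withConj (ellipticCoeff N c d)) (.inl p) (.inr q)
      = v * ((c * star c + d * star d) * swapCov p q.swap) := by
  simp only [gaussianCov, withConj, Sum.elim_inl, Sum.elim_inr, star_ellipticCoeff,
    sum_ellipticCoeff_mul]

theorem gaussianCov_ellipticCoeff_inr_inr :
    gaussianCov v (withConj (ellipticCoeff N c d)) (.inr p) (.inr q)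
      = v * (star (c ^ 2 + d ^ 2) * swapCov p q) := by
  have h : swapCov p.swap q.swap = swapCov p q := if_congr And.comm rfl rfl
  simp only [gaussianCov, withConj, Sum.elim_inr, star_ellipticCoeff, sum_ellipticCoeff_mul,
    star_add, sq, star_mul, h]

variable {κ n : Type*} [Fintype κ] [DecidableEq n] (E : κ → n × n → ℂ) (β : ℂ) (r s : n × n)

theorem gaussianCov_withConjShift_inl_inl :
    gaussianCov v (withConjShift E β) (.inl r) (.inl s)
      = gaussianCov v (withConj E) (.inl r) (.inl s) + v * (β ^ 2 * diagCov r s) := by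
  simp only [gaussianCov, Fintype.sum_sum_type, withConjShift, Sum.elim_inl, Sum.elim_inr,
    Fin.sum_univ_two, diagCov, mul_add]
  by_cases h1 : r.1 = r.2 <;> by_cases h2 : s.1 = s.2 <;> simp [h1, h2, sq]

/-- This is why two independent Gaussians are used: a common one would add `|β|²` terms to the mixed
block. -/
theorem gaussianCov_withConjShift_inl_inr :
    gaussianCov v (withConjShift E β) (.inl r) (.inr s)
      = gaussianCov v (withConj E) (.inl r) (.inr s) := by
  simp [gaussianCov, withConjShift]

theorem gaussianCov_withConjShift_inr_inr :
    gaussianCov v (withConjShift E β) (.inr r) (.inr s)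
      = gaussianCov v (withConj E) (.inr r) (.inr s) + v * (star β ^ 2 * diagCov r s) := by
  simp only [gaussianCov, Fintype.sum_sum_type, withConjShift, Sum.elim_inl, Sum.elim_inr,
    Fin.sum_univ_two, diagCov, mul_add]
  by_cases h1 : r.1 = r.2 <;> by_cases h2 : s.1 = s.2 <;> simp [h1, h2, sq]

theorem integral_detPairPoly_eq {c₀ d₀ : ℂ}
    (hs : c * star c + d * star d = c₀ * star c₀ + d₀ * star d₀)
    (hβ : c₀ ^ 2 + d₀ ^ 2 = c ^ 2 + d ^ 2 + β ^ 2) (B B' : Matrix (Fin N) (Fin N) ℂ) :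
    ∫ g, eval (fun a => ∑ k, withConj (ellipticCoeff N c d) k a * ((g k : ℝ) : ℂ))
        (detPairPoly B B') ∂gaussianPi _ v
      = ∫ g, eval (fun a => ∑ k, withConjShift (ellipticCoeff N c₀ d₀) β k a * ((g k : ℝ) : ℂ))
        (detPairPoly B B') ∂gaussianPi _ v := by
  have h12 : ∀ p q, gaussianCov v (withConj (ellipticCoeff N c d)) (.inl p) (.inr q)
      = gaussianCov v (withConjShift (ellipticCoeff N c₀ d₀) β) (.inl p) (.inr q) := by
    intro p q
    rw [gaussianCov_withConjShift_inl_inr, gaussianCov_ellipticCoeff_inl_inr,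
      gaussianCov_ellipticCoeff_inl_inr, hs]
  -- By `hβ`, the shifted vector has both an extra `v β²` of `swapCov` and an extra `v β²` of
  -- `diagCov`, hence `δ = -v β²`; the second block is conjugate.
  refine integral_gaussian_eq v _ _ _ (covLaplacian_detPairPoly_eq _ _ (-(v * β ^ 2))
    (-(v * star β ^ 2)) ?_ h12 ?_ ?_ B B')
  · intro p q
    rw [gaussianCov_withConjShift_inl_inl, gaussianCov_ellipticCoeff_inl_inl,
      gaussianCov_ellipticCoeff_inl_inl, hβ]
    ring
  · intro p q
    rw [gaussianCov_symm, h12, gaussianCov_symm]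
  · intro p q
    rw [gaussianCov_withConjShift_inr_inr, gaussianCov_ellipticCoeff_inr_inr,
      gaussianCov_ellipticCoeff_inr_inr, hβ, star_add _ (β ^ 2), star_pow β]
    ring

end Elliptic

/-! ### Elliptic laws as images of a real Gaussian vector -/

section Law

/-- The complex matrix with Gaussian coordinates `g` and coefficients `E`. -/
def matrixOfCoeff {κ n : Type*} [Fintype κ] (E : κ → n × n → ℂ) (g : κ → ℝ) : Matrix n n ℂ :=
  Matrix.of fun i j => ∑ k, E k (i, j) * (g k : ℂ)

theorem measurable_matrix_iff {α : Type*} [MeasurableSpace α] {N : ℕ}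
    {f : α → Matrix (Fin N) (Fin N) ℂ} :
    Measurable f ↔ ∀ i j, Measurable fun x => f x i j := by
  constructor
  · intro h i j
    exact (measurable_pi_apply j).comp ((measurable_pi_apply i).comp h)
  · intro h
    exact measurable_pi_lambda _ fun i => measurable_pi_lambda _ fun j => h i j

theorem Measurable.matrix_apply {α : Type*} [MeasurableSpace α] {N : ℕ}
    {f : α → Matrix (Fin N) (Fin N) ℂ} (hf : Measurable f) (i j : Fin N) :
    Measurable fun x => f x i j := measurable_matrix_iff.1 hf i j

theorem Measurable.matrix_det {α : Type*} [MeasurableSpace α] {N : ℕ}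
    {f : α → Matrix (Fin N) (Fin N) ℂ} (hf : Measurable f) : Measurable fun x => (f x).det := by
  simp only [Matrix.det_apply']
  exact Finset.measurable_sum _ fun σ _ => (Finset.measurable_prod _
    fun i _ => hf.matrix_apply _ _).const_mul _

theorem measurable_matrixOfCoeff {κ : Type*} [Fintype κ] {N : ℕ}
    (E : κ → Fin N × Fin N → ℂ) : Measurable (matrixOfCoeff E) := by
  refine measurable_matrix_iff.2 fun i j => ?_
  simp only [matrixOfCoeff, Matrix.of_apply]
  fun_prop

theorem hermitianOfCoords_eq_matrixOfCoeff (N : ℕ) :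
    hermitianOfCoords N = matrixOfCoeff (hermCoeff N) := by
  ext g i j
  exact hermitianOfCoords_apply N g (i, j)

theorem rotatedEllipticLaw_eq_map (N : ℕ) (θ a b : ℝ) :
    rotatedEllipticLaw N θ a b = (gaussianPi _ ((N : NNReal)⁻¹)).map
      (matrixOfCoeff (ellipticCoeff N (Complex.exp (Complex.I * θ) * a)
        (Complex.exp (Complex.I * θ) * (Complex.I * b)))) := by
  have hm := measurable_matrixOfCoeff (hermCoeff N)
  have hf : Measurable fun p : Matrix (Fin N) (Fin N) ℂ × Matrix (Fin N) (Fin N) ℂ =>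
      Complex.exp (Complex.I * θ) • ((a : ℂ) • p.1 + (Complex.I * (b : ℂ)) • p.2) := by
    refine measurable_matrix_iff.2 fun i j => ?_
    simp only [Matrix.smul_apply, Matrix.add_apply, smul_eq_mul]
    exact (((measurable_fst.matrix_apply i j).const_mul _).add
      ((measurable_snd.matrix_apply i j).const_mul _)).const_mul _
  rw [rotatedEllipticLaw, gueLaw, hermitianOfCoords_eq_matrixOfCoeff,
    Measure.map_prod_map _ _ hm hm,
    ← (measurePreserving_sumPiEquivProdPi (ι := Fin N × Fin N) (ι' := Fin N × Fin N)
      (X := fun _ => ℝ) (fun _ => gaussianReal 0 ((N : NNReal)⁻¹))).map_eq,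
    Measure.map_map (hm.prodMap hm) (MeasurableEquiv.measurable _),
    Measure.map_map hf ((hm.prodMap hm).comp (MeasurableEquiv.measurable _))]
  congr 1
  ext g i j
  simp [matrixOfCoeff, ellipticCoeff, MeasurableEquiv.sumPiEquivProdPi, Equiv.sumPiEquivProdPi,
    Fintype.sum_sum_type, mul_sum, mul_assoc]

end Law

/-! ### Recovering `s` and `τ` from the coefficients -/

section Parameters

variable {N : ℕ} (v : NNReal) (c d : ℂ)

theorem integral_entry_mul_entry (p q : Fin N × Fin N) :
    ∫ g, matrixOfCoeff (ellipticCoeff N c d) g p.1 p.2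
        * matrixOfCoeff (ellipticCoeff N c d) g q.1 q.2 ∂gaussianPi _ v
      = v * ((c ^ 2 + d ^ 2) * swapCov p q) := by
  rw [← gaussianCov_ellipticCoeff_inl_inl, ← integral_linear_mul_linear]
  rfl

theorem star_matrixOfCoeff {κ n : Type*} [Fintype κ] (E : κ → n × n → ℂ) (g : κ → ℝ) (q : n × n) :
    star (matrixOfCoeff E g q.1 q.2) = ∑ k, withConj E k (.inr q) * (g k : ℂ) := by
  simp [matrixOfCoeff, withConj]

theorem integral_entry_mul_star_entry (p q : Fin N × Fin N) :
    ∫ g, matrixOfCoeff (ellipticCoeff N c d) g p.1 p.2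
        * star (matrixOfCoeff (ellipticCoeff N c d) g q.1 q.2) ∂gaussianPi _ v
      = v * ((c * star c + d * star d) * swapCov p q.swap) := by
  rw [← gaussianCov_ellipticCoeff_inl_inr, ← integral_linear_mul_linear]
  simp only [star_matrixOfCoeff]
  rfl

theorem integrable_entry_mul_entry (p q : Fin N × Fin N) :
    Integrable (fun g => matrixOfCoeff (ellipticCoeff N c d) g p.1 p.2
        * matrixOfCoeff (ellipticCoeff N c d) g q.1 q.2) (gaussianPi _ v) := by
  have := integrable_eval_linear v (withConj (ellipticCoeff N c d)) (X (.inl p) * X (.inl q))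
  simp only [map_mul, eval_X] at this
  exact this

theorem integrable_entry_mul_star_entry (p q : Fin N × Fin N) :
    Integrable (fun g => matrixOfCoeff (ellipticCoeff N c d) g p.1 p.2
        * star (matrixOfCoeff (ellipticCoeff N c d) g q.1 q.2)) (gaussianPi _ v) := by
  have := integrable_eval_linear v (withConj (ellipticCoeff N c d)) (X (.inl p) * X (.inr q))
  simp only [map_mul, eval_X] at this
  simp only [star_matrixOfCoeff]
  exact this

theorem integral_trace_sq (hN : 0 < N) :
    ∫ g, (1 / (N : ℂ)) * (matrixOfCoeff (ellipticCoeff N c d) g ^ 2).trace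
      ∂gaussianPi _ ((N : NNReal)⁻¹) = c ^ 2 + d ^ 2 := by
  have hN' : (N : ℂ) ≠ 0 := by exact_mod_cast hN.ne'
  simp only [sq (matrixOfCoeff _ _), Matrix.trace, Matrix.diag, Matrix.mul_apply]
  rw [integral_const_mul, integral_finsetSum _ fun i _ => integrable_finsetSum _ fun j _ =>
    integrable_entry_mul_entry _ c d (i, j) (j, i)]
  simp only [integral_finsetSum _ fun j _ => integrable_entry_mul_entry _ c d (_, j) (j, _)]
  have h := fun i j : Fin N => integral_entry_mul_entry ((N : NNReal)⁻¹) c d (i, j) (j, i)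
  simp only [h]
  simp [swapCov]
  field_simp

theorem integral_trace_conjTranspose_mul (hN : 0 < N) :
    ∫ g, (1 / (N : ℂ)) * ((matrixOfCoeff (ellipticCoeff N c d) g).conjTranspose
        * matrixOfCoeff (ellipticCoeff N c d) g).trace
      ∂gaussianPi _ ((N : NNReal)⁻¹) = c * star c + d * star d := by
  have hN' : (N : ℂ) ≠ 0 := by exact_mod_cast hN.ne'
  simp only [Matrix.trace, Matrix.diag, Matrix.mul_apply, Matrix.conjTranspose_apply,
    mul_comm (star _)]
  have hi := fun i j : Fin N =>
    integrable_entry_mul_star_entry ((N : NNReal)⁻¹) c d (j, i) (j, i)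
  rw [integral_const_mul, integral_finsetSum _ fun i _ => integrable_finsetSum _ fun j _ => hi i j]
  simp only [fun i => integral_finsetSum univ fun j _ => hi i j]
  have h := fun i j : Fin N => integral_entry_mul_star_entry ((N : NNReal)⁻¹) c d (j, i) (j, i)
  simp only [h]
  simp [swapCov]
  field_simp

/-- The parameters of a rotated elliptic matrix in terms of its coefficients. -/
theorem IsRotatedElliptic.exists_coeff {Ω : Type*} [MeasurableSpace Ω] {P : Measure Ω}
    (hN : 0 < N) {Z : Ω → Matrix (Fin N) (Fin N) ℂ} {s : ℝ} {τ : ℂ}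
    (hZ : IsRotatedElliptic P Z s τ) :
    ∃ c d : ℂ, HasLaw Z ((gaussianPi _ ((N : NNReal)⁻¹)).map
        (matrixOfCoeff (ellipticCoeff N c d))) P ∧
      c * star c + d * star d = s ∧ c ^ 2 + d ^ 2 = s - τ := by
  obtain ⟨θ, a, b, -, hlaw⟩ := hZ.hasLaw
  rw [rotatedEllipticLaw_eq_map] at hlaw
  refine ⟨_, _, hlaw, ?_⟩
  set c := Complex.exp (Complex.I * θ) * a
  set d := Complex.exp (Complex.I * θ) * (Complex.I * b)
  have hm := measurable_matrixOfCoeff (ellipticCoeff N c d)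
  have hid : Measurable (id : Matrix (Fin N) (Fin N) ℂ → _) := measurable_id
  have m1 : Measurable fun M : Matrix (Fin N) (Fin N) ℂ =>
      (1 / (N : ℂ)) * (M.conjTranspose * M).trace := by
    simp only [Matrix.trace, Matrix.diag, Matrix.mul_apply, Matrix.conjTranspose_apply]
    refine (Finset.measurable_sum _ fun i _ => Finset.measurable_sum _ fun j _ => ?_).const_mul _
    exact (continuous_star.measurable.comp (hid.matrix_apply j i)).mul (hid.matrix_apply j i)
  have m2 : Measurable fun M : Matrix (Fin N) (Fin N) ℂ => (1 / (N : ℂ)) * (M ^ 2).trace := by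
    simp only [sq, Matrix.trace, Matrix.diag, Matrix.mul_apply]
    refine (Finset.measurable_sum _ fun i _ => Finset.measurable_sum _ fun j _ => ?_).const_mul _
    exact (hid.matrix_apply i j).mul (hid.matrix_apply j i)
  have e1 := hlaw.integral_comp m1.aestronglyMeasurable
  have e2 := hlaw.integral_comp m2.aestronglyMeasurable
  rw [integral_map hm.aemeasurable m1.aestronglyMeasurable,
    integral_trace_conjTranspose_mul c d hN] at e1
  rw [integral_map hm.aemeasurable m2.aestronglyMeasurable, integral_trace_sq c d hN] at e2
  have hs := hZ.variance_eq
  have hτ := hZ.covariance_eq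
  rw [← hs] at hτ
  refine ⟨e1.symm.trans hs.symm, ?_⟩
  rw [← e2, hτ, sub_sub_cancel]
  rfl

end Parameters

/-! ### The identity for deterministic `X₀` -/

section FixedMatrix

variable {N : ℕ}

theorem eval_heatOp_charpoly (v : NNReal) (β z : ℂ) (M : Matrix (Fin N) (Fin N) ℂ) :
    (heatOp (v * β ^ 2 / 2) M.charpoly).eval z
      = ∫ x : ℝ, (z • (1 : Matrix (Fin N) (Fin N) ℂ) + (β * x) • 1 - M).det
        ∂gaussianReal 0 v := by
  rw [eval_heatOp]
  simp only [Matrix.eval_charpoly, Matrix.scalar_apply, Matrix.smul_one_eq_diagonal,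
    Matrix.diagonal_add]

theorem measurable_eval_heatOp_charpoly (c z : ℂ) :
    Measurable fun M : Matrix (Fin N) (Fin N) ℂ => (heatOp c M.charpoly).eval z := by
  -- With variance 1 and `β² = 2c`, the heat operator becomes a parameter integral of a determinant,
  -- whose measurability is immediate.
  obtain ⟨β, hβ⟩ := IsAlgClosed.exists_pow_nat_eq (2 * c) two_pos
  have hc : c = ((1 : NNReal) : ℝ) * β ^ 2 / 2 := by rw [hβ]; simp
  simp only [hc, eval_heatOp_charpoly]
  refine (StronglyMeasurable.integral_prod_right ?_).measurable
  refine (Measurable.matrix_det (measurable_matrix_iff.2 fun i j => ?_)).stronglyMeasurable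
  simp only [Matrix.sub_apply, Matrix.add_apply, Matrix.smul_apply, smul_eq_mul]
  have := (measurable_fst (α := Matrix (Fin N) (Fin N) ℂ) (β := ℝ)).matrix_apply i j
  fun_prop

theorem lintegral_enorm_sq {α : Type*} [MeasurableSpace α] {μ : Measure α} {h : α → ℂ}
    (hi : Integrable (fun x => h x * star (h x)) μ) :
    ∫⁻ x, ‖h x‖ₑ ^ 2 ∂μ = ENNReal.ofReal (∫ x, h x * star (h x) ∂μ).re := by
  have e : ∀ x, h x * star (h x) = ((‖h x‖ ^ 2 : ℝ) : ℂ) := fun x => by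
    rw [Complex.star_def, Complex.mul_conj, Complex.normSq_eq_norm_sq]
  simp only [e] at hi ⊢
  rw [integral_complex_ofReal, Complex.ofReal_re, ofReal_integral_eq_lintegral_ofReal]
  · refine lintegral_congr fun x => ?_
    rw [ENNReal.ofReal_pow (norm_nonneg _), ofReal_norm]
  · simpa only [RCLike.re_to_complex, Complex.ofReal_re] using hi.re
  · exact Filter.Eventually.of_forall fun x => by positivity

theorem eval_detPairPoly {n : Type*} [Fintype n] [DecidableEq n] (B B' : Matrix n n ℂ)
    (x : n × n ⊕ n × n → ℂ) :
    eval x (detPairPoly B B') = (B - Matrix.of fun i j => x (.inl (i, j))).det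
      * (B' - Matrix.of fun i j => x (.inr (i, j))).det := by
  rw [detPairPoly, map_mul, eval_det_shiftedVarMatrix, eval_det_shiftedVarMatrix]

theorem eval_detPairPoly_withConj {κ : Type*} [Fintype κ] (E : κ → Fin N × Fin N → ℂ)
    (B : Matrix (Fin N) (Fin N) ℂ) (g : κ → ℝ) :
    eval (fun a => ∑ k, withConj E k a * ((g k : ℝ) : ℂ)) (detPairPoly B (B.map star))
      = (B - matrixOfCoeff E g).det * star (B - matrixOfCoeff E g).det := by
  rw [eval_detPairPoly]
  congr 1
  rw [← starRingEnd_apply, RingHom.map_det]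
  congr 1
  ext i j
  simp [matrixOfCoeff, withConj]

/-- The two shifts differ, so this is not yet a squared modulus; it becomes one after integrating
over the last two coordinates. -/
theorem eval_detPairPoly_withConjShift {κ : Type*} [Fintype κ] (E : κ → Fin N × Fin N → ℂ)
    (β : ℂ) (B : Matrix (Fin N) (Fin N) ℂ) (g : κ ⊕ Fin 2 → ℝ) :
    eval (fun a => ∑ k, withConjShift E β k a * ((g k : ℝ) : ℂ)) (detPairPoly B (B.map star))
      = (B + (β * g (.inr 0)) • 1 - matrixOfCoeff E (g ∘ Sum.inl)).det
        * star (B + (β * g (.inr 1)) • 1 - matrixOfCoeff E (g ∘ Sum.inl)).det := by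
  rw [eval_detPairPoly]
  congr 1
  · congr 1
    ext i j
    by_cases hij : i = j
    · simp [matrixOfCoeff, withConj, withConjShift, hij]
      ring
    · simp [matrixOfCoeff, withConj, withConjShift, hij]
  · rw [← starRingEnd_apply, RingHom.map_det]
    congr 1
    ext i j
    by_cases hij : i = j
    · simp [matrixOfCoeff, withConj, withConjShift, hij]
      ring
    · simp [matrixOfCoeff, withConj, withConjShift, hij]

theorem integral_gaussianPi_sum {κ κ' : Type*} [Fintype κ] [Fintype κ'] (v : NNReal)
    (F : (κ ⊕ κ' → ℝ) → ℂ) (hF : Integrable F (gaussianPi (κ ⊕ κ') v)) :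
    Integrable (fun g => ∫ y, F (Sum.elim g y) ∂gaussianPi κ' v) (gaussianPi κ v) ∧
    ∫ x, F x ∂gaussianPi (κ ⊕ κ') v
      = ∫ g, ∫ y, F (Sum.elim g y) ∂gaussianPi κ' v ∂gaussianPi κ v := by
  have mp := measurePreserving_sumPiEquivProdPi_symm (ι := κ) (ι' := κ')
      (X := fun _ => ℝ) (fun _ => gaussianReal 0 v)
  have e : ∀ p : (κ → ℝ) × (κ' → ℝ),
      (MeasurableEquiv.sumPiEquivProdPi (fun _ : κ ⊕ κ' => ℝ)).symm p = Sum.elim p.1 p.2 := by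
    intro p
    ext (k | k) <;> rfl
  have hi : Integrable (fun p : (κ → ℝ) × (κ' → ℝ) => F (Sum.elim p.1 p.2))
      ((gaussianPi κ v).prod (gaussianPi κ' v)) := by
    have := (mp.integrable_comp_emb (MeasurableEquiv.measurableEmbedding _) (g := F)).2 hF
    simpa only [Function.comp_def, e] using this
  refine ⟨hi.integral_prod_left, ?_⟩
  rw [← integral_prod _ hi, ← mp.integral_comp']
  simp only [e]

theorem lintegral_det_eq_lintegral_heatOp (v : NNReal) {c d c₀ d₀ β : ℂ}
    (hs : c * star c + d * star d = c₀ * star c₀ + d₀ * star d₀)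
    (hβ : c₀ ^ 2 + d₀ ^ 2 = c ^ 2 + d ^ 2 + β ^ 2) (A : Matrix (Fin N) (Fin N) ℂ) (z : ℂ) :
    ∫⁻ g, ‖(z • (1 : Matrix (Fin N) (Fin N) ℂ)
        - (A + matrixOfCoeff (ellipticCoeff N c d) g)).det‖ₑ ^ 2 ∂gaussianPi _ v
      = ∫⁻ g, ‖(heatOp (v * β ^ 2 / 2)
        (A + matrixOfCoeff (ellipticCoeff N c₀ d₀) g).charpoly).eval z‖ₑ ^ 2
        ∂gaussianPi _ v := by
  set B : Matrix (Fin N) (Fin N) ℂ := z • 1 - A with hB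
  have hsub : ∀ M, z • (1 : Matrix (Fin N) (Fin N) ℂ) - (A + M) = B - M := fun M => by
    rw [hB, sub_sub]
  have hadd : ∀ (w : ℂ) M, z • (1 : Matrix (Fin N) (Fin N) ℂ) + w • 1 - (A + M)
      = B + w • 1 - M := fun w M => by rw [hB]; abel
  simp only [eval_heatOp_charpoly, hsub, hadd]
  have hi := integrable_eval_linear v (withConj (ellipticCoeff N c d)) (detPairPoly B (B.map star))
  simp only [eval_detPairPoly_withConj] at hi
  have hi₀ := integrable_eval_linear v (withConjShift (ellipticCoeff N c₀ d₀) β)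
    (detPairPoly B (B.map star))
  simp only [eval_detPairPoly_withConjShift] at hi₀
  obtain ⟨hj, hj'⟩ := integral_gaussianPi_sum v _ hi₀
  -- For fixed `g` the two shifts are independent, so the integral factors into the heat-evolved
  -- determinant and its conjugate.
  have key : ∀ g : (Fin N × Fin N) ⊕ (Fin N × Fin N) → ℝ,
      ∫ y : Fin 2 → ℝ, (B + (β * (Sum.elim g y (.inr 0) : ℝ)) • 1
          - matrixOfCoeff (ellipticCoeff N c₀ d₀) (Sum.elim g y ∘ Sum.inl)).det
        * star (B + (β * (Sum.elim g y (.inr 1) : ℝ)) • 1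
          - matrixOfCoeff (ellipticCoeff N c₀ d₀) (Sum.elim g y ∘ Sum.inl)).det
          ∂gaussianPi (Fin 2) v
      = (∫ x : ℝ, (B + (β * x) • 1 - matrixOfCoeff (ellipticCoeff N c₀ d₀) g).det
          ∂gaussianReal 0 v)
        * star (∫ x : ℝ, (B + (β * x) • 1 - matrixOfCoeff (ellipticCoeff N c₀ d₀) g).det
          ∂gaussianReal 0 v) := by
    intro g
    have h := integral_fintype_prod_eq_prod (μ := fun _ : Fin 2 => gaussianReal 0 v)
      (![fun x : ℝ => (B + (β * x) • 1 - matrixOfCoeff (ellipticCoeff N c₀ d₀) g).det,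
        fun x : ℝ => star (B + (β * x) • 1 - matrixOfCoeff (ellipticCoeff N c₀ d₀) g).det])
    simp only [Fin.prod_univ_two, Matrix.cons_val_zero, Matrix.cons_val_one] at h
    simp only [Sum.elim_inr, Sum.elim_comp_inl]
    rw [h]
    congr 1
    exact integral_conj
  simp only [key] at hj hj'
  rw [lintegral_enorm_sq hi, lintegral_enorm_sq hj, ← hj']
  have := integral_detPairPoly_eq N v c d β hs hβ B (B.map star)
  simp only [eval_detPairPoly_withConj, eval_detPairPoly_withConjShift] at this
  rw [this]

end FixedMatrix

/-! ### Conditioning on `X₀` -/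

theorem lintegral_comp_of_indepFun {Ω α β γ : Type*} [MeasurableSpace Ω] [MeasurableSpace α]
    [MeasurableSpace β] [MeasurableSpace γ] {P : Measure Ω} [IsProbabilityMeasure P] {X : Ω → α}
    {Y : Ω → β} {ν : Measure γ} {T : γ → β} (hX : AEMeasurable X P) (hT : Measurable T)
    (hY : HasLaw Y (ν.map T) P) (hXY : IndepFun X Y P) {F : α → β → ENNReal}
    (hF : Measurable (Function.uncurry F)) :
    ∫⁻ ω, F (X ω) (Y ω) ∂P = ∫⁻ x, ∫⁻ g, F x (T g) ∂ν ∂P.map X := by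
  have hm := hY.aemeasurable
  have hFx : ∀ x, Measurable (F x) := fun x => hF.of_uncurry_left
  simp only [← lintegral_map (hFx _) hT, ← hY.map_eq]
  have : IsProbabilityMeasure (P.map Y) := Measure.isProbabilityMeasure_map hm
  change _ = ∫⁻ x, ∫⁻ y, Function.uncurry F (x, y) ∂P.map Y ∂P.map X
  rw [← lintegral_prod (Function.uncurry F) hF.aemeasurable,
    ← (indepFun_iff_map_prod_eq_prod_map_map hX hm).1 hXY,
    lintegral_map' hF.aemeasurable (hX.prodMk hm)]
  rfl

end

theorem mainTheorem1 {Ω : Type*} [MeasurableSpace Ω] (P : Measure Ω) [IsProbabilityMeasure P]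
    (N : ℕ) (hN : 0 < N) (s : ℝ) (hs : 0 < s) (τ₀ τ : ℂ)
    (hτ₀ : ‖τ₀ - (s : ℂ)‖ ≤ s) (hτ : ‖τ - (s : ℂ)‖ ≤ s)
    (X₀ Zτ₀ Zτ : Ω → Matrix (Fin N) (Fin N) ℂ)
    (hX₀ : AEMeasurable X₀ P)
    (hZτ₀ : IsRotatedElliptic P Zτ₀ s τ₀) (hZτ : IsRotatedElliptic P Zτ s τ)
    (hindep₀ : IndepFun X₀ Zτ₀ P) (hindep : IndepFun X₀ Zτ P) (z : ℂ) :
    ∫⁻ ω, ‖(z • (1 : Matrix (Fin N) (Fin N) ℂ) - (X₀ ω + Zτ ω)).det‖ₑ ^ 2 ∂P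
      = ∫⁻ ω, ‖(heatOp ((τ - τ₀) / (2 * (N : ℂ))) (X₀ ω + Zτ₀ ω).charpoly).eval z‖ₑ ^ 2 ∂P := by
  obtain ⟨c₀, d₀, hlaw₀, hv₀, hc₀⟩ := hZτ₀.exists_coeff hN
  obtain ⟨c, d, hlaw, hv, hc⟩ := hZτ.exists_coeff hN
  -- `τ - τ₀` is the difference of `c₀² + d₀² = s - τ₀` and `c² + d² = s - τ`. A complex root is
  -- enough, since only covariances without conjugation enter.
  obtain ⟨β, hβ⟩ := IsAlgClosed.exists_pow_nat_eq (τ - τ₀) two_pos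
  have hadd : Measurable fun p : Matrix (Fin N) (Fin N) ℂ × Matrix (Fin N) (Fin N) ℂ =>
      p.1 + p.2 := by
    refine measurable_matrix_iff.2 fun i j => ?_
    simp only [Matrix.add_apply]
    exact (measurable_fst.matrix_apply i j).add (measurable_snd.matrix_apply i j)
  have hF : Measurable (Function.uncurry fun A M : Matrix (Fin N) (Fin N) ℂ =>
      ‖(z • (1 : Matrix (Fin N) (Fin N) ℂ) - (A + M)).det‖ₑ ^ 2) := by
    refine (Measurable.matrix_det (measurable_matrix_iff.2 fun i j => ?_)).enorm.pow_const 2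
    exact (hadd.matrix_apply i j).const_sub _
  have hG : Measurable (Function.uncurry fun A M : Matrix (Fin N) (Fin N) ℂ =>
      ‖(heatOp ((τ - τ₀) / (2 * (N : ℂ))) (A + M).charpoly).eval z‖ₑ ^ 2) :=
    ((measurable_eval_heatOp_charpoly _ z).comp hadd).enorm.pow_const 2
  have hcoef : (τ - τ₀) / (2 * (N : ℂ)) = (((N : NNReal)⁻¹ : NNReal) : ℝ) * β ^ 2 / 2 := by
    rw [hβ]
    push_cast
    rw [div_eq_mul_inv, mul_inv]
    ring
  refine (lintegral_comp_of_indepFun hX₀ (measurable_matrixOfCoeff _) hlaw hindep hF).trans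
    ((lintegral_congr fun A => ?_).trans
      (lintegral_comp_of_indepFun hX₀ (measurable_matrixOfCoeff _) hlaw₀ hindep₀ hG).symm)
  rw [hcoef]
  exact lintegral_det_eq_lintegral_heatOp _ (hv.trans hv₀.symm)
    (by rw [hc, hc₀, hβ]; ring) A z
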